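/- Let $G$ be a real, finite-dimensional (smooth) Lie group with Lie algebra $\mathfrak g=T_eG$, whose bracket is the bracket at $e$ of left-invariant vector fields. Let $k\ge 0$ and let $\omega$ be a smooth real-valued $k$-form on $G$ that is left-invariant, i.e. $L_g^*\omega=\omega$ for all $g\in G$, where $L_g(h)=gh$. Let $d$ be the exterior derivative, given on open subsets of a vector space (and hence in charts of $G$) by $$(d\omega)_v(v_0,\dots,v_k)=\sum_{i=0}^k(-1)^i\,\frac{\partial\omega_v}{\partial v}(v_i)(v_0,\dots,\widehat{v_i},\dots,v_k).$$ Then for all $Z_0,\dots,Z_k\in\mathfrak g$ the Chevalley–Eilenberg formula holds: $$d\omega(Z_0,\dots,Z_k)=\sum_{0\le i<j\le k}(-1)^{i+j}\,\omega([Z_i,Z_j],Z_0,\dots,\widehat{Z_i},\dots,\widehat{Z_j},\dots,Z_k),$$ where a hat means that the entry is omitted (for $k=0$ the sum is empty, so $d\omega=0$). The formula holds both for the values at the identity $e$, and at every point $g\in G$ when each element $Z$ of $\mathfrak g$ (the $Z_i$ as well as the brackets $[Z_i,Z_j]$) is replaced by the value $gZ=DL_g(e)Z$ at $g$ of the corresponding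 left-invariant vector field. -/

import Mathlib

open scoped Manifold ContDiff

noncomputable section

/-- Pull-back of a (not necessarily smooth) field `α` of alternating `k`-linear forms by a map `F`:
`(F^*α)_x (u₁, …, u_k) = α_{F x} (DF(x) u₁, …, DF(x) u_k)`. -/
def formPullback {E E' M M' : Type*}
    [NormedAddCommGroup E] [NormedSpace ℝ E] [TopologicalSpace M] [ChartedSpace E M]
    [NormedAddCommGroup E'] [NormedSpace ℝ E'] [TopologicalSpace M'] [ChartedSpace E' M'] {k : ℕ}
    (F : M → M') (α : (y : M') → TangentSpace 𝓘(ℝ, E') y [⋀^Fin k]→L[ℝ] ℝ) (x : M) :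
    TangentSpace 𝓘(ℝ, E) x [⋀^Fin k]→L[ℝ] ℝ :=
  (α (F x)).compContinuousLinearMap (mfderiv 𝓘(ℝ, E) 𝓘(ℝ, E') F x)

/-- The expression, in the preferred chart `φ` at `p`, of a field of alternating forms on `M`:
the pull-back by `φ⁻¹`. It is meaningful on the (open) target of `φ`. -/
def formInChart {E M : Type*} [NormedAddCommGroup E] [NormedSpace ℝ E]
    [TopologicalSpace M] [ChartedSpace E M] {k : ℕ}
    (α : (x : M) → TangentSpace 𝓘(ℝ, E) x [⋀^Fin k]→L[ℝ] ℝ) (p : M) :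
    E → E [⋀^Fin k]→L[ℝ] ℝ :=
  fun y => formPullback (E := E) (M := E) (extChartAt 𝓘(ℝ, E) p).symm α y

/-- A smooth (real-valued) differential `k`-form on the manifold `M` modelled on `E`: a field of
alternating `k`-linear forms on the tangent spaces whose expression in charts is smooth. -/
structure SmoothForm (E M : Type*) [NormedAddCommGroup E] [NormedSpace ℝ E]
    [TopologicalSpace M] [ChartedSpace E M] (k : ℕ) where
  /-- the value at a point -/
  toFun : (x : M) → TangentSpace 𝓘(ℝ, E) x [⋀^Fin k]→L[ℝ] ℝ
  smooth_inChart : ∀ p : M,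
    ContDiffOn ℝ ∞ (formInChart toFun p) (extChartAt 𝓘(ℝ, E) p).target

/-- The exterior derivative of a smooth `k`-form. Its value at `x` is computed in the preferred
chart `φ` at `x`, as `φ^* d((φ⁻¹)^* α)`, where the `d` of a form on an open subset of the vector
space `E` is `(dη)_v (v₀, …, v_k) = ∑ i, (-1)^i (∂η_v/∂v)(v_i) (v₀, …, v̂_i, …, v_k)`. -/
def SmoothForm.d {E M : Type*} [NormedAddCommGroup E] [NormedSpace ℝ E]
    [TopologicalSpace M] [ChartedSpace E M] {k : ℕ} (α : SmoothForm E M k) (x : M) :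
    TangentSpace 𝓘(ℝ, E) x [⋀^Fin (k + 1)]→L[ℝ] ℝ :=
  formPullback (E' := E) (M' := E) (extChartAt 𝓘(ℝ, E) x)
    (extDeriv (E := E) (formInChart α.toFun x)) x

/-- A form on a group is left-invariant if its pull-backs by all left translations are itself. -/
def SmoothForm.IsLeftInvariant {E G : Type*} [NormedAddCommGroup E] [NormedSpace ℝ E]
    [TopologicalSpace G] [ChartedSpace E G] [Group G] {k : ℕ} (α : SmoothForm E G k) : Prop :=
  ∀ g : G, formPullback (fun h => g * h) α.toFun = α.toFun

/-- For `i < j`, the `k`-tuple `([Z_i, Z_j], Z_0, …, Ẑ_i, …, Ẑ_j, …, Z_k)` (hats mean "omit"). Its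
entry in position `0` is the bracket; its entry in position `m ≥ 1` is `Z_{m-1}` if `m ≤ i`, it is
`Z_m` if `i < m < j`, and `Z_{m+1}` if `m ≥ j`. -/
def bracketTuple {L : Type*} [Bracket L L] {k : ℕ} (Z : Fin (k + 1) → L) (i j : Fin (k + 1)) :
    Fin k → L :=
  fun m =>
    if (m : ℕ) = 0 then ⁅Z i, Z j⁆
    else if (m : ℕ) ≤ i then Z ⟨m - 1, by omega⟩
    else if (m : ℕ) < j then Z ⟨m, by omega⟩
    else Z ⟨m + 1, by omega⟩

end

/-! For vector fields `V_i`, `dω(V_0, …, V_k)` is the alternating sum of the derivatives of `ω(…,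
V̂_i, …)` along `V_i`, plus bracket terms. A left-invariant form is constant on left-invariant
fields, so the derivative terms vanish; left-invariant fields are closed under bracket, so the rest
is the Chevalley–Eilenberg sum. The vector-space formula `extDeriv_apply_vectorField` is carried to
the manifold by pulling the fields back through the chart at the point
(`SmoothForm.d_apply_of_const`). -/

theorem SmoothForm.d_apply {E M : Type*} [NormedAddCommGroup E]
    [NormedSpace ℝ E] [TopologicalSpace M] [ChartedSpace E M] {k : ℕ}
    (α : SmoothForm E M k) (x : M) (v : Fin (k + 1) → TangentSpace 𝓘(ℝ, E) x) :
    α.d x v = extDeriv (E := E) (formInChart α.toFun x) (extChartAt 𝓘(ℝ, E) x x)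
      (fun i => mfderiv 𝓘(ℝ, E) 𝓘(ℝ, E) (extChartAt 𝓘(ℝ, E) x) x (v i)) :=
  rfl

/-- In a chart, a form evaluated on pulled-back vector fields takes the original values. -/
theorem formInChart_mpullbackWithin {E M : Type*} [NormedAddCommGroup E]
    [NormedSpace ℝ E] [TopologicalSpace M] [ChartedSpace E M]
    [IsManifold 𝓘(ℝ, E) 1 M] {k : ℕ}
    (α : (x : M) → TangentSpace 𝓘(ℝ, E) x [⋀^Fin k]→L[ℝ] ℝ) (p : M)
    {y : E} (hy : y ∈ (extChartAt 𝓘(ℝ, E) p).target)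
    (V : Fin k → (x : M) → TangentSpace 𝓘(ℝ, E) x) :
    formInChart α p y (fun m => VectorField.mpullbackWithin 𝓘(ℝ, E) 𝓘(ℝ, E)
        (extChartAt 𝓘(ℝ, E) p).symm (V m) (Set.range 𝓘(ℝ, E)) y) =
      α ((extChartAt 𝓘(ℝ, E) p).symm y)
        (fun m => V m ((extChartAt 𝓘(ℝ, E) p).symm y)) := by
  have hinv := isInvertible_mfderivWithin_extChartAt_symm (I := 𝓘(ℝ, E)) hy
  change α _ (fun m => mfderiv 𝓘(ℝ, E) 𝓘(ℝ, E) (extChartAt 𝓘(ℝ, E) p).symm y _) = _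
  refine congrArg _ (funext fun m => ?_)
  rw [VectorField.mpullbackWithin_apply]
  rw [ModelWithCorners.range_eq_univ, mfderivWithin_univ] at hinv ⊢
  exact hinv.self_apply_inverse _

theorem mpullbackWithin_extChartAt_symm_apply_self {E M : Type*} [NormedAddCommGroup E]
    [NormedSpace ℝ E] [TopologicalSpace M] [ChartedSpace E M] [IsManifold 𝓘(ℝ, E) 1 M] (x : M)
    (V : (y : M) → TangentSpace 𝓘(ℝ, E) y) :
    VectorField.mpullbackWithin 𝓘(ℝ, E) 𝓘(ℝ, E) (extChartAt 𝓘(ℝ, E) x).symm V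
        (Set.range 𝓘(ℝ, E)) (extChartAt 𝓘(ℝ, E) x x) =
      mfderiv 𝓘(ℝ, E) 𝓘(ℝ, E) (extChartAt 𝓘(ℝ, E) x) x (V x) := by
  -- `φ.symm (φ x) = x` is not definitional, so the two values are compared in the model space `E`.
  have key : ∀ y : M, y = x → (V y : E) = V x := by rintro _ rfl; rfl
  have h : (mfderivWithin 𝓘(ℝ, E) 𝓘(ℝ, E) (extChartAt 𝓘(ℝ, E) x).symm (Set.range 𝓘(ℝ, E))
      (extChartAt 𝓘(ℝ, E) x x)).inverse = mfderiv 𝓘(ℝ, E) 𝓘(ℝ, E) (extChartAt 𝓘(ℝ, E) x) x :=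
    ContinuousLinearMap.inverse_eq
      (mfderivWithin_extChartAt_symm_comp_mfderiv_extChartAt' (mem_extChartAt_source x))
      (mfderiv_extChartAt_comp_mfderivWithin_extChartAt_symm' (mem_extChartAt_source x))
  rw [VectorField.mpullbackWithin_apply, h]
  exact congrArg (mfderiv 𝓘(ℝ, E) 𝓘(ℝ, E) (extChartAt 𝓘(ℝ, E) x) x)
    (key _ (extChartAt_to_inv x))

theorem formInChart_mfderiv_extChartAt {E M : Type*} [NormedAddCommGroup E]
    [NormedSpace ℝ E] [TopologicalSpace M] [ChartedSpace E M] [IsManifold 𝓘(ℝ, E) 1 M] {k : ℕ}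
    (α : (x : M) → TangentSpace 𝓘(ℝ, E) x [⋀^Fin k]→L[ℝ] ℝ) (x : M)
    (v : Fin k → TangentSpace 𝓘(ℝ, E) x) :
    formInChart α x (extChartAt 𝓘(ℝ, E) x x)
        (fun m => mfderiv 𝓘(ℝ, E) 𝓘(ℝ, E) (extChartAt 𝓘(ℝ, E) x) x (v m)) = α x v := by
  have h := mfderivWithin_extChartAt_symm_comp_mfderiv_extChartAt' (I := 𝓘(ℝ, E))
    (mem_extChartAt_source (I := 𝓘(ℝ, E)) x)
  rw [ModelWithCorners.range_eq_univ, mfderivWithin_univ] at h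
  have key : ∀ y : M, y = x →
      (α y : E [⋀^Fin k]→L[ℝ] ℝ) v = (α x : E [⋀^Fin k]→L[ℝ] ℝ) v := by rintro _ rfl; rfl
  refine Eq.trans ?_ (key _ (extChartAt_to_inv (I := 𝓘(ℝ, E)) x))
  exact congrArg (α ((extChartAt 𝓘(ℝ, E) x).symm (extChartAt 𝓘(ℝ, E) x x)))
    (funext fun m => DFunLike.congr_fun h (v m))

/-- The manifold bracket is defined by applying the inverse of the chart's derivative to the bracket
in the chart; the derivative cancels it. -/
theorem mfderiv_extChartAt_mlieBracket {E M : Type*} [NormedAddCommGroup E]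
    [NormedSpace ℝ E] [TopologicalSpace M] [ChartedSpace E M] [IsManifold 𝓘(ℝ, E) 1 M] (x : M)
    (V W : (y : M) → TangentSpace 𝓘(ℝ, E) y) :
    mfderiv 𝓘(ℝ, E) 𝓘(ℝ, E) (extChartAt 𝓘(ℝ, E) x) x
        (VectorField.mlieBracket 𝓘(ℝ, E) V W x) =
      VectorField.lieBracket ℝ
        (VectorField.mpullbackWithin 𝓘(ℝ, E) 𝓘(ℝ, E) (extChartAt 𝓘(ℝ, E) x).symm V
          (Set.range 𝓘(ℝ, E)))
        (VectorField.mpullbackWithin 𝓘(ℝ, E) 𝓘(ℝ, E) (extChartAt 𝓘(ℝ, E) x).symm W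
          (Set.range 𝓘(ℝ, E))) (extChartAt 𝓘(ℝ, E) x x) := by
  have key : ∀ (A B : E → E) (s : Set E), s = Set.univ →
      VectorField.lieBracketWithin ℝ A B s = VectorField.lieBracket ℝ A B := by
    rintro A B _ rfl; exact VectorField.lieBracketWithin_univ
  exact Eq.trans ((isInvertible_mfderiv_extChartAt
    (mem_extChartAt_source (I := 𝓘(ℝ, E)) x)).self_apply_inverse _)
    (congrFun (key _ _ ((extChartAt 𝓘(ℝ, E) x).symm ⁻¹' Set.univ ∩ Set.range 𝓘(ℝ, E))
      (by simp)) _)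

open VectorField Finset in
/-- The exterior derivative of a smooth form on vector fields on which the form takes constant
values: only the bracket terms of the general formula survive. -/
theorem SmoothForm.d_apply_of_const {E M : Type*} [NormedAddCommGroup E]
    [NormedSpace ℝ E] [CompleteSpace E] [TopologicalSpace M] [ChartedSpace E M]
    [IsManifold 𝓘(ℝ, E) 2 M] {n : ℕ} (α : SmoothForm E M (n + 1)) (x : M)
    (V : Fin (n + 2) → (y : M) → TangentSpace 𝓘(ℝ, E) y)
    (hV : ∀ i, MDiffAt (T% (V i)) x)
    (c : Fin (n + 2) → ℝ) (hc : ∀ i y, α.toFun y (fun m => V (i.succAbove m) y) = c i) :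
    α.d x (fun i => V i x) = - ∑ i : Fin (n + 1), ∑ j ∈ Finset.Ici i,
      (-1 : ℝ) ^ ((i : ℕ) + (j : ℕ)) * α.toFun x (Fin.cons (α := fun _ => TangentSpace 𝓘(ℝ, E) x)
        (mlieBracket 𝓘(ℝ, E) (V i.castSucc) (V j.succ) x)
        (fun m => V (i.castSucc.succAbove (j.succAbove m)) x)) := by
  set φ := extChartAt 𝓘(ℝ, E) x
  have : IsManifold 𝓘(ℝ, E) 1 M := IsManifold.of_le (n := 2) one_le_two
  have htgt : φ.target ∈ nhds (φ x) := extChartAt_target_mem_nhds x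
  let W : Fin (n + 2) → E → E := fun i =>
    mpullbackWithin 𝓘(ℝ, E) 𝓘(ℝ, E) φ.symm (V i) (Set.range 𝓘(ℝ, E))
  have hW : ∀ i, DifferentiableAt ℝ (W i) (φ x) := fun i => by
    have h := ((hV i).mdifferentiableWithinAt (s := Set.univ)
      ).differentiableWithinAt_mpullbackWithin_vectorField
    have huniv : (extChartAt 𝓘(ℝ, E) x).symm ⁻¹' Set.univ ∩ Set.range 𝓘(ℝ, E) = Set.univ := by
      simp
    rw [huniv] at h
    exact differentiableWithinAt_univ.1 h
  have hω : DifferentiableAt ℝ (formInChart α.toFun x) (φ x) :=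
    ((α.smooth_inChart x).contDiffAt htgt).differentiableAt (by simp)
  have hWx : ∀ i, W i (φ x) = mfderiv 𝓘(ℝ, E) 𝓘(ℝ, E) φ x (V i x) := fun i =>
    mpullbackWithin_extChartAt_symm_apply_self x (V i)
  -- These are the derivative terms; constancy is known only on the chart target, a neighbourhood of
  -- `φ x`.
  have hconst : ∀ i : Fin (n + 2),
      fderiv ℝ (fun y => formInChart α.toFun x y (i.removeNth (W · y))) (φ x) = 0 := fun i => by
    have h : (fun y => formInChart α.toFun x y (i.removeNth (W · y))) =ᶠ[nhds (φ x)]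
        fun _ => c i := by
      filter_upwards [htgt] with y hy
      rw [← hc i (φ.symm y)]
      exact formInChart_mpullbackWithin α.toFun x hy (fun m => V (i.succAbove m))
    rw [h.fderiv_eq, fderiv_fun_const]
    rfl
  have hd : α.d x (fun i => V i x) = extDeriv (formInChart α.toFun x) (φ x) (W · (φ x)) :=
    congrArg (extDeriv (E := E) (formInChart α.toFun x) (φ x)) (funext fun i => (hWx i).symm)
  rw [hd, extDeriv_apply_vectorField hω hW]
  simp only [hconst, zero_apply, smul_zero, Finset.sum_const_zero, zero_sub]
  refine congrArg _ (Finset.sum_congr rfl fun i _ => Finset.sum_congr rfl fun j _ => ?_)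
  refine (zsmul_eq_mul _ _).trans (congrArg₂ (· * ·) (by simp) ?_)
  refine Eq.trans ?_ (formInChart_mfderiv_extChartAt α.toFun x _)
  refine congrArg (formInChart α.toFun x (φ x)) (funext fun m => ?_)
  refine Fin.cases ?_ (fun m => ?_) m
  · exact (mfderiv_extChartAt_mlieBracket x _ _).symm
  · exact hWx _

theorem Fin.sum_sum_Ioi_eq_sum_sum_Ici {A : Type*} [AddCommMonoid A] {n : ℕ}
    (f : Fin (n + 2) → Fin (n + 2) → A) :
    ∑ i, ∑ j ∈ Finset.Ioi i, f i j =
      ∑ i : Fin (n + 1), ∑ j ∈ Finset.Ici i, f i.castSucc j.succ := by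
  rw [Fin.sum_univ_castSucc]
  have h : Finset.Ioi (Fin.last (n + 1)) = ∅ := by ext j; simp [Fin.le_last]
  rw [h, Finset.sum_empty, add_zero]
  refine Finset.sum_congr rfl fun i _ => ?_
  have h' : Finset.Ioi i.castSucc = (Finset.Ici i).map (Fin.succEmb (n + 1)) := by
    rw [Fin.map_succEmb_Ici]; ext j; simp [Fin.castSucc_lt_iff_succ_le]
  rw [h', Finset.sum_map]
  rfl

/-- Since `i ≤ j`, omitting entry `i` moves entry `j + 1` to position `j`, so omitting position `j`
next removes it. -/
theorem bracketTuple_castSucc_succ {L : Type*} [Bracket L L] {n : ℕ} (Z : Fin (n + 2) → L)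
    {i j : Fin (n + 1)} (hij : i ≤ j) :
    bracketTuple Z i.castSucc j.succ =
      Fin.cons ⁅Z i.castSucc, Z j.succ⁆ (fun m => Z (i.castSucc.succAbove (j.succAbove m))) := by
  ext m
  refine Fin.cases ?_ (fun m => ?_) m
  · simp [bracketTuple]
  · rw [Fin.cons_succ]
    have hij' : (i : ℕ) ≤ j := hij
    simp only [bracketTuple, Fin.val_succ, Fin.val_castSucc, Fin.succAbove, Fin.lt_def]
    rw [if_neg (by omega)]
    split_ifs <;> simp only [Fin.val_succ, Fin.val_castSucc] at * <;>
      first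
        | omega
        | rfl

/-- A left-invariant form is constant on left-invariant vector fields. -/
theorem SmoothForm.IsLeftInvariant.toFun_mulInvariantVectorField {E G : Type*}
    [NormedAddCommGroup E] [NormedSpace ℝ E] [TopologicalSpace G] [ChartedSpace E G] [Group G]
    {k : ℕ} {α : SmoothForm E G k} (hα : α.IsLeftInvariant) (g : G)
    (w : Fin k → GroupLieAlgebra 𝓘(ℝ, E) G) :
    α.toFun g (fun m => mulInvariantVectorField (w m) g) = α.toFun 1 w := by
  have h := congrArg (fun β => β w) (congrFun (hα g) 1)
  have key : ∀ h : G, h = g → ∀ u : Fin k → E,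
      (α.toFun h : E [⋀^Fin k]→L[ℝ] ℝ) u = (α.toFun g : E [⋀^Fin k]→L[ℝ] ℝ) u := by
    rintro _ rfl u; rfl
  exact (key (g * 1) (mul_one g) _).symm.trans h

theorem mulInvariantVectorField_one {E G : Type*}
    [NormedAddCommGroup E] [NormedSpace ℝ E] [TopologicalSpace G] [ChartedSpace E G] [Group G]
    (v : GroupLieAlgebra 𝓘(ℝ, E) G) : mulInvariantVectorField v 1 = v := by
  have h : (fun x : G => 1 * x) = id := by ext; simp
  simp only [mulInvariantVectorField]
  rw [h, mfderiv_id]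
  rfl

theorem SmoothForm.d_eq_zero_of_const {E M : Type*} [NormedAddCommGroup E]
    [NormedSpace ℝ E] [TopologicalSpace M] [ChartedSpace E M]
    (α : SmoothForm E M 0) (x : M) (c : ℝ) (hc : ∀ y v, α.toFun y v = c) :
    α.d x = 0 := by
  have h : formInChart α.toFun x =
      fun _ => ContinuousAlternatingMap.constOfIsEmpty ℝ E (Fin 0) c := by
    ext y v
    exact hc _ _
  have h' : extDeriv (formInChart α.toFun x) (extChartAt 𝓘(ℝ, E) x x) = 0 := by
    rw [h, extDeriv_constOfIsEmpty]
    ext v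
    simp
  ext v
  rw [SmoothForm.d_apply, h']
  rfl

/-- The Chevalley–Eilenberg formula for the exterior derivative of a left-invariant form, at an
arbitrary point of the group. -/
theorem SmoothForm.IsLeftInvariant.d_apply_mulInvariantVectorField {E : Type*}
    [NormedAddCommGroup E] [NormedSpace ℝ E] [FiniteDimensional ℝ E]
    {G : Type*} [TopologicalSpace G] [ChartedSpace E G] [Group G] [LieGroup 𝓘(ℝ, E) ∞ G]
    {k : ℕ} {α : SmoothForm E G k} (hα : α.IsLeftInvariant)
    (Z : Fin (k + 1) → GroupLieAlgebra 𝓘(ℝ, E) G) (g : G) :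
    α.d g (fun l => mulInvariantVectorField (Z l) g) =
        ∑ i : Fin (k + 1), ∑ j ∈ Finset.Ioi i,
          (-1 : ℝ) ^ ((i : ℕ) + (j : ℕ)) *
            α.toFun g (fun m => mulInvariantVectorField (bracketTuple Z i j m) g) := by
  have : CompleteSpace E := FiniteDimensional.complete ℝ E
  have : LieGroup 𝓘(ℝ, E) (minSmoothness ℝ 3) G :=
    LieGroup.of_le (n := ∞) (by
      rw [minSmoothness_of_isRCLikeNormedField]; exact WithTop.coe_le_coe.2 le_top)
  have : IsManifold 𝓘(ℝ, E) 2 G := IsManifold.of_le (n := ∞) (WithTop.coe_le_coe.2 le_top)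
  -- Degree 0 is separate: `SmoothForm.d_apply_of_const` needs positive degree. There `α` is a
  -- constant function.
  rcases k with _ | n
  · rw [α.d_eq_zero_of_const g (α.toFun 1 (fun m => m.elim0)) fun y v => ?_]
    · simp
    · rw [← hα.toFun_mulInvariantVectorField y]
      exact congrArg (α.toFun y) (funext fun m => m.elim0)
  rw [Fin.sum_sum_Ioi_eq_sum_sum_Ici,
    α.d_apply_of_const g (fun l => mulInvariantVectorField (Z l))
      (fun i => mdifferentiableAt_mulInvariantVectorField _)
      (fun i => α.toFun 1 (fun m => Z (i.succAbove m)))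
      (fun i y => hα.toFun_mulInvariantVectorField y _), ← Finset.sum_neg_distrib]
  refine Finset.sum_congr rfl fun i _ => ?_
  rw [← Finset.sum_neg_distrib]
  refine Finset.sum_congr rfl fun j hj => ?_
  -- The shift from `j` to `j + 1` in the exponent absorbs the minus sign. The bracket of invariant
  -- fields is the invariant field of its value at `1`, which is the Lie algebra bracket.
  rw [bracketTuple_castSucc_succ Z (Finset.mem_Ici.1 hj), Fin.val_castSucc, Fin.val_succ,
    ← add_assoc, pow_succ, mul_neg_one, neg_mul, ← mulInvariantVector_mlieBracket]
  congr 2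
  refine congrArg _ (funext fun m => ?_)
  refine Fin.cases ?_ (fun m => ?_) m <;> rfl

theorem mainTheorem5 {E : Type*} [NormedAddCommGroup E] [NormedSpace ℝ E] [FiniteDimensional ℝ E]
    {G : Type*} [TopologicalSpace G] [ChartedSpace E G] [Group G] [LieGroup 𝓘(ℝ, E) ∞ G]
    (k : ℕ) (α : SmoothForm E G k) (hα : α.IsLeftInvariant)
    (Z : Fin (k + 1) → GroupLieAlgebra 𝓘(ℝ, E) G) :
    α.d 1 Z =
        ∑ i : Fin (k + 1), ∑ j ∈ Finset.Ioi i,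
          (-1 : ℝ) ^ ((i : ℕ) + (j : ℕ)) * α.toFun 1 (bracketTuple Z i j) ∧
      ∀ g : G, α.d g (fun l => mulInvariantVectorField (Z l) g) =
        ∑ i : Fin (k + 1), ∑ j ∈ Finset.Ioi i,
          (-1 : ℝ) ^ ((i : ℕ) + (j : ℕ)) *
            α.toFun g (fun m => mulInvariantVectorField (bracketTuple Z i j m) g) := by
  refine ⟨?_, hα.d_apply_mulInvariantVectorField Z⟩
  have h := hα.d_apply_mulInvariantVectorField Z 1
  simp only [hα.toFun_mulInvariantVectorField] at h
  rw [← h]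
  exact congrArg (α.d 1) (funext fun l => (mulInvariantVectorField_one (Z l)).symm)
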